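/- Let $X$ be a Banach space over $\mathbb K\in\{\mathbb R,\mathbb C\}$ with topological dual $X^*$, and let $B_{X^*}$ be the closed unit ball of $X^*$. Let $G$ be a group of linear isometric isomorphisms of $X$ onto itself which is compact in the operator-norm topology of $\mathcal L(X)$, and let $X_G=\{x\in X : g(x)=x \text{ for all } g\in G\}$. Let $w^*_G$ be the topology on $X^*$ generated by the sets $$\{f\in X^* : \operatorname{Re}\langle f-f_0,x_i\rangle<\varepsilon,\ 1\le i\le n\},\qquad f_0\in X^*,\ x_1,\dots,x_n\in X_G,\ \varepsilon>0.$$ Let $C\subseteq X^*$ be convex and $G^*$-invariant, i.e. $g^*(C)=C$ for every $g\in G$, where $g^*f=f\circ g$. If $\delta B_{X^*}\cap C$ is $w^*_G$-closed in $X^*$ for every $\delta>0$, then $C$ is $w^*_G$-closed in $X^*$. More generally, the same conclusion holds if, for every $\delta>0$, $\delta B_{X^*}\cap C$ is only relatively $w^*_G$-closed in $\delta B_{X^*}$, i.e. $\delta B_{X^*}\cap C=\delta B_{X^*}\cap F$ for some $w^*_G$-closed set $F\subseteq X^*$. -/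

import Mathlib

open scoped Topology

namespace GInv

section

variable {𝕜 : Type*} [RCLike 𝕜] {X : Type*} [NormedAddCommGroup X] [NormedSpace 𝕜 X]

/-- The group `G` of linear isometric isomorphisms of `X` is compact for the relative topology
of `𝓛(X)`, i.e. its set of operators is compact in the operator norm topology. -/
def IsCompactGroup (G : Subgroup (X ≃ₗᵢ[𝕜] X)) : Prop :=
  IsCompact {T : X →L[𝕜] X | ∃ g ∈ G, T = (g.toContinuousLinearEquiv : X →L[𝕜] X)}

/-- `X_G`, the set of `G`-invariant points of `X`. -/
def fixedPoints (G : Subgroup (X ≃ₗᵢ[𝕜] X)) : Set X :=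
  {x | ∀ g ∈ G, g x = x}

/-- The adjoint `g^* : X^* → X^*`, `g^* f = f ∘ g`. -/
def adj (g : X ≃ₗᵢ[𝕜] X) (f : StrongDual 𝕜 X) : StrongDual 𝕜 X :=
  f.comp (g.toContinuousLinearEquiv : X →L[𝕜] X)

/-- `C ⊆ X^*` is `G^*`-invariant: `g^*(C) = C` for every `g ∈ G`. -/
def IsDualInvariant (G : Subgroup (X ≃ₗᵢ[𝕜] X)) (C : Set (StrongDual 𝕜 X)) : Prop :=
  ∀ g ∈ G, adj g '' C = C

/-- The basic set `{f | Re ⟨f - f₀, x⟩ < ε for all x ∈ s}` (over `ℝ`, `Re` is the identity). -/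
def basicSet (f₀ : StrongDual 𝕜 X) (s : Finset X) (ε : ℝ) : Set (StrongDual 𝕜 X) :=
  {f | ∀ x ∈ s, RCLike.re ((f - f₀) x) < ε}

/-- The group invariant weak-star topology `w^*_G` on `X^*`, generated by the basic sets
with `f₀ ∈ X^*`, finitely many points of `X_G`, and `ε > 0`. -/
@[reducible] def weakStarG (G : Subgroup (X ≃ₗᵢ[𝕜] X)) : TopologicalSpace (StrongDual 𝕜 X) :=
  TopologicalSpace.generateFrom
    {U | ∃ (f₀ : StrongDual 𝕜 X) (s : Finset X) (ε : ℝ),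
      (s : Set X) ⊆ fixedPoints G ∧ 0 < ε ∧ U = basicSet f₀ s ε}

end

end GInv

namespace GInv

open scoped ZeroAtInfty
open Filter Set WeakDual

/-! ### Krein–Šmulian separation in the dual of a Banach space -/

section KreinSmulian

variable {𝕜 : Type*} [RCLike 𝕜] {Y : Type*} [NormedAddCommGroup Y] [NormedSpace 𝕜 Y]

section ZeroAtInfty

variable {ι : Type*} [TopologicalSpace ι]

/-! Restricting functionals to the Banach space `X_G` reduces the claim to the classical
Krein–Šmulian theorem. Two functionals with equal restrictions lie in a common ball, where the
hypothesis cannot tell them apart, so `C` is saturated for restriction. Norm-preserving extension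
then makes the image of `C` weak-star closed in every ball, and a vector of `X_G` separating the
images separates `C` itself. For the classical theorem (`krein_smulian_separation`), Banach–Alaoglu
yields finite sets of vectors, shrinking to zero, whose translated polar misses the set. Evaluating
on these vectors maps the dual into c₀, where Hahn–Banach separates the image from the unit ball;
the separating functional on c₀ is given by one vector. -/

lemma norm_zeroAtInfty_le {a : C₀(ι, 𝕜)} {M : ℝ} (hM : 0 ≤ M) (h : ∀ i, ‖a i‖ ≤ M) :
    ‖a‖ ≤ M := by
  rw [← ZeroAtInftyContinuousMap.norm_toBCF_eq_norm]
  exact (BoundedContinuousFunction.norm_le hM).2 h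

lemma norm_apply_le_norm_zeroAtInfty (a : C₀(ι, 𝕜)) (i : ι) : ‖a i‖ ≤ ‖a‖ := by
  rw [← ZeroAtInftyContinuousMap.norm_toBCF_eq_norm]
  exact a.toBCF.norm_coe_le_norm i

variable [DiscreteTopology ι]

/-- A family tending to zero along the cofinite filter, as an element of `c₀`. -/
def ofTendstoCofinite (a : ι → 𝕜) (ha : Tendsto a cofinite (𝓝 0)) : C₀(ι, 𝕜) where
  toFun := a
  continuous_toFun := continuous_of_discreteTopology
  zero_at_infty' := by rwa [cocompact_eq_cofinite]

@[simp]
lemma ofTendstoCofinite_apply (a : ι → 𝕜) (ha : Tendsto a cofinite (𝓝 0)) (i : ι) :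
    ofTendstoCofinite a ha i = a i := rfl

open Classical in
/-- The canonical unit vectors of `c₀`. -/
noncomputable def unitVector (i : ι) : C₀(ι, 𝕜) :=
  ofTendstoCofinite (Pi.single i 1) <| tendsto_nhds_of_eventually_eq <| by
    filter_upwards [(finite_singleton i).compl_mem_cofinite] with j hj
    exact Pi.single_eq_of_ne hj _

open Classical in
lemma sum_smul_unitVector_apply (s : Finset ι) (a : ι → 𝕜) (j : ι) :
    (∑ i ∈ s, a i • (unitVector i : C₀(ι, 𝕜))) j = if j ∈ s then a j else 0 := by
  have h : ∀ t : Finset ι, (∑ i ∈ t, a i • (unitVector i : C₀(ι, 𝕜))) j =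
      ∑ i ∈ t, a i * (Pi.single i 1 : ι → 𝕜) j := by
    intro t
    induction t using Finset.induction_on with
    | empty => simp
    | insert i t hi ih =>
      rw [Finset.sum_insert hi, Finset.sum_insert hi, ZeroAtInftyContinuousMap.add_apply, ih]
      rfl
  rw [h]
  simp [Pi.single_apply]

/-- A partial sum differs from `a` only off its index set, and `a` is uniformly small off a finite
set. -/
lemma hasSum_smul_unitVector (a : C₀(ι, 𝕜)) :
    HasSum (fun i => a i • (unitVector i : C₀(ι, 𝕜))) a := by
  have ha : Tendsto a cofinite (𝓝 0) := by
    rw [← cocompact_eq_cofinite]; exact a.zero_at_infty'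
  rw [HasSum, SummationFilter.unconditional_filter, Metric.tendsto_nhds]
  intro ε hε
  have hfin : {i | ¬ ‖a i‖ < ε / 2}.Finite := by
    have := (tendsto_zero_iff_norm_tendsto_zero.1 ha).eventually_lt_const (half_pos hε)
    exact eventually_cofinite.1 this
  filter_upwards [eventually_ge_atTop hfin.toFinset] with s hs
  rw [dist_eq_norm]
  refine (norm_zeroAtInfty_le (half_pos hε).le fun j => ?_).trans_lt (half_lt_self hε)
  rw [ZeroAtInftyContinuousMap.sub_apply, sum_smul_unitVector_apply]
  split_ifs with hj
  · simpa using (half_pos hε).le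
  · rw [zero_sub, norm_neg]
    by_contra hlt
    exact hj (hs (hfin.mem_toFinset.2 fun h => hlt h.le))

/-- A continuous functional on `c₀` sends a null family to a summable family of multiples. -/
lemma summable_apply_unitVector_smul [CompleteSpace Y] (φ : StrongDual 𝕜 C₀(ι, 𝕜)) {v : ι → Y}
    (hv : Tendsto v cofinite (𝓝 0)) :
    Summable fun i => φ (unitVector i) • v i := by
  rw [summable_iff_vanishing_norm]
  intro ε hε
  obtain ⟨η, hη, hηε⟩ : ∃ η : ℝ, 0 < η ∧ ‖φ‖ * η < ε := by
    refine ⟨ε / (‖φ‖ + 1), by positivity, ?_⟩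
    rw [mul_div_assoc', div_lt_iff₀ (by positivity)]
    nlinarith
  have hfin : {i | ¬ ‖v i‖ < η}.Finite :=
    eventually_cofinite.1 ((tendsto_zero_iff_norm_tendsto_zero.1 hv).eventually_lt_const hη)
  refine ⟨hfin.toFinset, fun t ht => lt_of_le_of_lt ?_ hηε⟩
  -- A norming functional moves the estimate into c₀, where the sup norm does not grow with the size
  -- of `t`.
  obtain ⟨f, hf, hfv⟩ := exists_dual_vector'' 𝕜 (∑ i ∈ t, φ (unitVector i) • v i)
  have key : f (∑ i ∈ t, φ (unitVector i) • v i) =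
      φ (∑ i ∈ t, f (v i) • (unitVector i : C₀(ι, 𝕜))) := by
    simp [map_sum, mul_comm]
  have hnorm : ‖∑ i ∈ t, φ (unitVector i) • v i‖ =
      ‖φ (∑ i ∈ t, f (v i) • (unitVector i : C₀(ι, 𝕜)))‖ := by
    rw [← key, hfv]; simp
  rw [hnorm]
  refine (φ.le_opNorm _).trans (mul_le_mul_of_nonneg_left ?_ (norm_nonneg _))
  refine norm_zeroAtInfty_le hη.le fun j => ?_
  rw [sum_smul_unitVector_apply]
  split_ifs with hj
  · have hvj : ‖v j‖ < η := by
      by_contra h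
      exact Finset.disjoint_left.1 ht hj (hfin.mem_toFinset.2 h)
    calc ‖f (v j)‖ ≤ ‖f‖ * ‖v j‖ := f.le_opNorm _
      _ ≤ 1 * η := by gcongr
      _ = η := one_mul η
  · simpa using hη.le

/-- A convex set of functionals lying outside the polar of a null family is separated from zero
by a single vector. -/
lemma exists_one_le_re_of_null_family [CompleteSpace Y] {v : ι → Y}
    (hv : Tendsto v cofinite (𝓝 0)) {D : Set (StrongDual 𝕜 Y)} (hD : Convex ℝ D)
    (h : ∀ f ∈ D, ∃ i, 1 < ‖f (v i)‖) :
    ∃ y : Y, ∀ f ∈ D, 1 ≤ RCLike.re (f y) := by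
  have hnull : ∀ f : StrongDual 𝕜 Y, Tendsto (fun i => f (v i)) cofinite (𝓝 0) := fun f => by
    simpa [Function.comp_def] using (f.continuous.tendsto 0).comp hv
  let T : StrongDual 𝕜 Y → C₀(ι, 𝕜) := fun f => ofTendstoCofinite _ (hnull f)
  have hTconv : Convex ℝ (T '' D) := by
    rintro _ ⟨f, hf, rfl⟩ _ ⟨g, hg, rfl⟩ a b ha hb hab
    exact ⟨a • f + b • g, hD hf hg ha hb hab, by ext i; rfl⟩
  have hdisj : Disjoint (Metric.ball (0 : C₀(ι, 𝕜)) 1) (T '' D) := by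
    rw [Set.disjoint_right]
    rintro _ ⟨f, hf, rfl⟩ hball
    obtain ⟨i, hi⟩ := h f hf
    rw [mem_ball_zero_iff] at hball
    exact absurd (norm_apply_le_norm_zeroAtInfty (T f) i) (not_le.2 (hball.trans hi))
  obtain ⟨φ, u, hφ, hu⟩ := RCLike.geometric_hahn_banach_open (𝕜 := 𝕜)
    (convex_ball (0 : C₀(ι, 𝕜)) 1) Metric.isOpen_ball hTconv hdisj
  have hu0 : 0 < u := by simpa using hφ 0 (Metric.mem_ball_self one_pos)
  have happ : ∀ f : StrongDual 𝕜 Y, f (∑' i, φ (unitVector i) • v i) = φ (T f) := fun f => by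
    have h1 := (summable_apply_unitVector_smul φ hv).hasSum.mapL f
    have h2 := (hasSum_smul_unitVector (T f)).mapL φ
    refine h1.unique ?_
    convert h2 using 2 with i
    simp [T, mul_comm]
  refine ⟨((u⁻¹ : ℝ) : 𝕜) • ∑' i, φ (unitVector i) • v i, fun f hf => ?_⟩
  rw [map_smul, happ, smul_eq_mul, RCLike.re_ofReal_mul]
  calc (1 : ℝ) = u⁻¹ * u := (inv_mul_cancel₀ hu0.ne').symm
    _ ≤ u⁻¹ * RCLike.re (φ (T f)) := by
      gcongr
      exact hu _ ⟨f, hf, rfl⟩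

end ZeroAtInfty

/-- A weak-star compact set of functionals at distance more than `R` from `f₀` lies outside the
translated polar of a finite set of vectors of norm at most `R⁻¹`. -/
lemma exists_finset_one_lt_norm {K : Set (WeakDual 𝕜 Y)} (hK : IsCompact K) {R : ℝ} (hR : 0 < R)
    (f₀ : StrongDual 𝕜 Y) (h : ∀ f ∈ K, R < ‖toStrongDual f - f₀‖) :
    ∃ F : Finset Y, (∀ x ∈ F, ‖x‖ ≤ R⁻¹) ∧
      ∀ f ∈ K, ∃ x ∈ F, 1 < ‖(toStrongDual f - f₀) x‖ := by
  have hopen : ∀ x : Y, IsOpen {f : WeakDual 𝕜 Y | 1 < ‖(toStrongDual f - f₀) x‖} := fun x =>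
    isOpen_lt continuous_const (((WeakDual.eval_continuous x).sub continuous_const).norm)
  obtain ⟨t, ht, hfin, hcov⟩ := hK.elim_finite_subcover_image
    (b := Metric.closedBall (0 : Y) R⁻¹) (fun x _ => hopen x) (by
      intro f hf
      obtain ⟨x, hx, hfx⟩ := ContinuousLinearMap.exists_lt_apply_of_lt_opNorm _ (h f hf)
      refine mem_iUnion₂.2 ⟨((R⁻¹ : ℝ) : 𝕜) • x, ?_, ?_⟩
      · rw [mem_closedBall_zero_iff, norm_smul, RCLike.norm_ofReal, abs_of_pos (inv_pos.2 hR)]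
        exact mul_le_of_le_one_right (inv_pos.2 hR).le hx.le
      · change 1 < ‖(toStrongDual f - f₀) (((R⁻¹ : ℝ) : 𝕜) • x)‖
        rw [map_smul, norm_smul, RCLike.norm_ofReal, abs_of_pos (inv_pos.2 hR),
          ← inv_mul_cancel₀ hR.ne']
        gcongr)
  refine ⟨hfin.toFinset, fun x hx => ?_, fun f hf => ?_⟩
  · exact mem_closedBall_zero_iff.1 (ht (hfin.mem_toFinset.1 hx))
  · obtain ⟨x, hx, hfx⟩ := mem_iUnion₂.1 (hcov hf)
    exact ⟨x, hfin.mem_toFinset.2 hx, hfx⟩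

open Classical in
/-- The inductive construction in the Krein–Šmulian theorem: finite sets of vectors of norm
tending to zero, outside whose translated polar the set `D` lies. -/
lemma exists_seq_finset_one_lt_norm {D : Set (StrongDual 𝕜 Y)}
    (hclosed : ∀ δ : ℝ, 0 < δ → IsClosed (toStrongDual ⁻¹' (Metric.closedBall 0 δ ∩ D)))
    {f₀ : StrongDual 𝕜 Y} {r : ℝ} (hr : 0 < r) (h : ∀ f ∈ D, r < ‖f - f₀‖) :
    ∃ F : ℕ → Finset Y, (∀ n, ∀ x ∈ F n, ‖x‖ ≤ (r + n)⁻¹) ∧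
      ∀ f ∈ D, ∃ n, ∃ x ∈ F n, 1 < ‖(f - f₀) x‖ := by
  let P : ℕ → Finset Y → Prop := fun n S =>
    ∀ f ∈ D, ‖f - f₀‖ ≤ r + n → ∃ x ∈ S, 1 < ‖(f - f₀) x‖
  have step : ∀ (n : ℕ) (S : Finset Y), ∃ F : Finset Y, (∀ x ∈ F, ‖x‖ ≤ (r + n)⁻¹) ∧
      (P n S → P (n + 1) (S ∪ F)) := by
    intro n S
    by_cases hP : P n S
    swap
    -- Nothing is required here; treating every pair lets `choose` produce a total function.
    · exact ⟨∅, by simp, fun h => absurd h hP⟩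
    -- The ball about `f₀` gives compactness; the ball about 0 contains it and is there only so that
    -- `hclosed` applies.
    let K : Set (WeakDual 𝕜 Y) := (toStrongDual ⁻¹' Metric.closedBall f₀ (r + (n + 1 : ℕ))) ∩
      ((toStrongDual ⁻¹' (Metric.closedBall 0 (‖f₀‖ + (r + (n + 1 : ℕ))) ∩ D)) ∩
      {f | ∀ x ∈ S, ‖(toStrongDual f - f₀) x‖ ≤ 1})
    have hKc : IsCompact K := by
      refine (WeakDual.isCompact_closedBall f₀ _).inter_right
        ((hclosed _ (by positivity)).inter ?_)
      simp only [ofPred_forall]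
      exact isClosed_biInter fun x _ =>
        isClosed_le (((WeakDual.eval_continuous x).sub continuous_const).norm) continuous_const
    obtain ⟨F, hF, hKF⟩ := exists_finset_one_lt_norm hKc (R := r + n) (by positivity) f₀ (by
      rintro f ⟨-, ⟨-, hfD⟩, hfS⟩
      by_contra hle
      obtain ⟨x, hx, hfx⟩ := hP _ hfD (not_lt.1 hle)
      exact absurd (hfS x hx) (not_le.2 hfx))
    refine ⟨F, hF, fun _ f hfD hf => ?_⟩
    have hnorm : ‖f‖ ≤ ‖f₀‖ + (r + (n + 1 : ℕ)) :=
      (norm_le_norm_add_norm_sub' f f₀).trans (by gcongr)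
    by_cases hS : ∀ x ∈ S, ‖(f - f₀) x‖ ≤ 1
    · obtain ⟨x, hx, hfx⟩ := hKF (StrongDual.toWeakDual f)
        ⟨mem_closedBall_iff_norm.2 hf, ⟨mem_closedBall_zero_iff.2 hnorm, hfD⟩, hS⟩
      exact ⟨x, Finset.mem_union_right _ hx, hfx⟩
    · push Not at hS
      obtain ⟨x, hx, hfx⟩ := hS
      exact ⟨x, Finset.mem_union_left _ hx, hfx⟩
  choose F hF hFP using step
  let S : ℕ → Finset Y := fun n => Nat.rec ∅ (fun k T => T ∪ F k T) n
  have hS : ∀ n, P n (S n) := by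
    intro n
    induction n with
    | zero => intro f hf hle; exact absurd (h f hf) (not_lt.2 (by simpa using hle))
    | succ n ih => exact hFP n _ ih
  have hmem : ∀ n, ∀ x ∈ S n, ∃ k, x ∈ F k (S k) := by
    intro n
    induction n with
    | zero => intro x hx; exact absurd hx (Finset.notMem_empty x)
    | succ n ih =>
      intro x hx
      rcases Finset.mem_union.1 hx with hx | hx
      exacts [ih x hx, ⟨n, hx⟩]
  refine ⟨fun n => F n (S n), fun n => hF n _, fun f hf => ?_⟩
  obtain ⟨n, hn⟩ := exists_nat_ge (‖f - f₀‖)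
  obtain ⟨x, hx, hfx⟩ := hS n f hf (hn.trans (le_add_of_nonneg_left hr.le))
  obtain ⟨k, hk⟩ := hmem n x hx
  exact ⟨k, x, hk, hfx⟩

/-- **Krein–Šmulian theorem**: if a convex set `D` in the dual of a Banach space has weak-star
closed intersections with all balls, then every point outside `D` is strictly separated from `D`
by a vector. -/
theorem krein_smulian_separation [CompleteSpace Y] {D : Set (StrongDual 𝕜 Y)} (hD : Convex ℝ D)
    (hclosed : ∀ δ : ℝ, 0 < δ → IsClosed (toStrongDual ⁻¹' (Metric.closedBall 0 δ ∩ D)))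
    {f₀ : StrongDual 𝕜 Y} (hf₀ : f₀ ∉ D) :
    ∃ y : Y, ∀ f ∈ D, 1 ≤ RCLike.re ((f - f₀) y) := by
  obtain ⟨r, hr, hrD⟩ : ∃ r : ℝ, 0 < r ∧ ∀ f ∈ D, r < ‖f - f₀‖ := by
    -- Weak-star closed implies norm closed; points within 1 of `f₀` stay in this ball.
    have hc : IsClosed (Metric.closedBall 0 (‖f₀‖ + 1) ∩ D) :=
      (hclosed (‖f₀‖ + 1) (by positivity)).preimage
        NormedSpace.Dual.toWeakDual_continuous
    obtain ⟨ε, hε, hball⟩ := Metric.isOpen_iff.1 hc.isOpen_compl f₀ fun h => hf₀ h.2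
    refine ⟨min (ε / 2) 1, by positivity, fun f hf => ?_⟩
    by_contra! hle
    refine hball (a := f) ?_ ⟨?_, hf⟩
    · rw [mem_ball_iff_norm]
      exact (hle.trans (min_le_left _ _)).trans_lt (half_lt_self hε)
    · rw [mem_closedBall_zero_iff]
      have := norm_le_norm_add_norm_sub' f f₀
      linarith [hle.trans (min_le_right _ _)]
  obtain ⟨F, hF, hFD⟩ := exists_seq_finset_one_lt_norm hclosed hr hrD
  let ι := Σ n, {x // x ∈ F n}
  let : TopologicalSpace ι := ⊥
  have : DiscreteTopology ι := ⟨rfl⟩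
  have hv : Tendsto (fun i : ι => (i.2 : Y)) cofinite (𝓝 0) := by
    rw [Metric.tendsto_nhds]
    intro ε hε
    obtain ⟨N, hN⟩ := exists_nat_gt ε⁻¹
    rw [eventually_cofinite]
    refine ((Finset.range N).finite_toSet.preimage' (f := Sigma.fst) fun n _ => ?_).subset
      fun i hi => ?_
    · have : (Sigma.fst ⁻¹' {n} : Set ι) = range fun x : {x // x ∈ F n} => (⟨n, x⟩ : ι) := by
        ext ⟨m, x⟩
        constructor
        · rintro rfl; exact ⟨x, rfl⟩
        · rintro ⟨y, hy⟩; exact (congrArg Sigma.fst hy).symm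
      rw [this]
      exact finite_range _
    · rw [mem_preimage, Finset.mem_coe, Finset.mem_range]
      by_contra! hle
      refine hi ?_
      rw [dist_zero_right]
      refine (hF _ _ i.2.2).trans_lt (inv_lt_of_inv_lt₀ hε (hN.trans_le ?_))
      have : (N : ℝ) ≤ i.1 := by exact_mod_cast hle
      linarith
  obtain ⟨y, hy⟩ := exists_one_le_re_of_null_family (𝕜 := 𝕜) hv
    (D := (fun f => -f₀ + f) '' D) (hD.translate (-f₀)) (by
      rintro _ ⟨f, hf, rfl⟩
      obtain ⟨n, x, hx, hfx⟩ := hFD f hf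
      exact ⟨⟨n, x, hx⟩, by simpa [neg_add_eq_sub] using hfx⟩)
  exact ⟨y, fun f hf => by simpa [neg_add_eq_sub] using hy _ ⟨f, hf, rfl⟩⟩

end KreinSmulian

/-! ### Restriction to the fixed points and transfer to `w^*_G` -/

section Fixed

variable {𝕜 : Type*} [RCLike 𝕜] {X : Type*} [NormedAddCommGroup X] [NormedSpace 𝕜 X]

/-- The fixed points of a group of isometries, as a submodule. -/
def fixedSubmodule (G : Subgroup (X ≃ₗᵢ[𝕜] X)) : Submodule 𝕜 X where
  carrier := fixedPoints G
  add_mem' hx hy g hg := by rw [map_add, hx g hg, hy g hg]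
  zero_mem' g _ := map_zero g
  smul_mem' c x hx g hg := by rw [map_smul, hx g hg]

lemma isClosed_fixedSubmodule (G : Subgroup (X ≃ₗᵢ[𝕜] X)) :
    IsClosed (fixedSubmodule G : Set X) := by
  change IsClosed {x : X | ∀ g ∈ G, g x = x}
  simp only [ofPred_forall]
  exact isClosed_biInter fun g _ => isClosed_eq g.continuous continuous_id

/-- Restriction of functionals to the fixed points. -/
def restrictFixed (G : Subgroup (X ≃ₗᵢ[𝕜] X)) (f : StrongDual 𝕜 X) :
    StrongDual 𝕜 (fixedSubmodule G) :=
  f.comp (fixedSubmodule G).subtypeL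

lemma norm_restrictFixed_le (G : Subgroup (X ≃ₗᵢ[𝕜] X)) (f : StrongDual 𝕜 X) :
    ‖restrictFixed G f‖ ≤ ‖f‖ :=
  ContinuousLinearMap.opNorm_le_bound _ (norm_nonneg f) fun x => f.le_opNorm x

lemma exists_restrictFixed_eq (G : Subgroup (X ≃ₗᵢ[𝕜] X))
    (d : StrongDual 𝕜 (fixedSubmodule G)) : ∃ f, restrictFixed G f = d ∧ ‖f‖ = ‖d‖ := by
  obtain ⟨f, hf, hn⟩ := exists_extension_norm_eq (fixedSubmodule G) d
  exact ⟨f, by ext x; exact hf x, hn⟩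

/-- A `w^*_G`-closed set is the preimage, under restriction to the fixed points, of a weak-star
closed set. -/
lemma exists_preimage_of_isClosed_weakStarG (G : Subgroup (X ≃ₗᵢ[𝕜] X))
    {F : Set (StrongDual 𝕜 X)} (hF : IsClosed[weakStarG G] F) :
    ∃ E : Set (WeakDual 𝕜 (fixedSubmodule G)), IsClosed E ∧
      (fun f => StrongDual.toWeakDual (restrictFixed G f)) ⁻¹' E = F := by
  refine isClosed_induced_iff.1 (IsClosed.mono hF (le_generateFrom ?_))
  rintro _ ⟨f₀, s, ε, hs, -, rfl⟩
  refine isOpen_induced_iff.2 ⟨⋂ x : s, {d | RCLike.re (d ⟨x, hs x.2⟩ - f₀ x) < ε},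
    isOpen_iInter_of_finite fun x => ?_, ?_⟩
  · exact isOpen_lt (RCLike.continuous_re.comp
      ((WeakDual.eval_continuous _).sub continuous_const)) continuous_const
  · ext f
    simp only [mem_preimage, mem_iInter, Subtype.forall]
    exact Iff.rfl

/-- The Krein–Šmulian theorem for the topology `w^*_G`. -/
theorem isClosed_weakStarG_of_inter_closedBall [CompleteSpace X] (G : Subgroup (X ≃ₗᵢ[𝕜] X))
    {C : Set (StrongDual 𝕜 X)} (hconv : Convex ℝ C)
    (h : ∀ δ : ℝ, 0 < δ → ∃ F : Set (StrongDual 𝕜 X), IsClosed[weakStarG G] F ∧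
      Metric.closedBall 0 δ ∩ C = Metric.closedBall 0 δ ∩ F) :
    IsClosed[weakStarG G] C := by
  have : CompleteSpace (fixedSubmodule G) := (isClosed_fixedSubmodule G).completeSpace_coe
  have h' : ∀ δ : ℝ, 0 < δ → ∃ E : Set (WeakDual 𝕜 (fixedSubmodule G)), IsClosed E ∧
      ∀ f : StrongDual 𝕜 X, ‖f‖ ≤ δ →
        (f ∈ C ↔ StrongDual.toWeakDual (restrictFixed G f) ∈ E) := by
    intro δ hδ
    obtain ⟨F, hF, hCF⟩ := h δ hδ
    obtain ⟨E, hE, rfl⟩ := exists_preimage_of_isClosed_weakStarG G hF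
    refine ⟨E, hE, fun f hf => ?_⟩
    have := Set.ext_iff.1 hCF f
    simpa [hf] using this
  have hsat : ∀ f ∈ C, ∀ f' : StrongDual 𝕜 X,
      restrictFixed G f' = restrictFixed G f → f' ∈ C := by
    intro f hf f' hff'
    -- The radius is chosen so that one ball contains both `f` and `f'`.
    obtain ⟨E, -, hE⟩ := h' (‖f‖ + ‖f'‖ + 1) (by positivity)
    rw [hE f' (by linarith [norm_nonneg f]), hff', ← hE f (by linarith [norm_nonneg f'])]
    exact hf
  have hD : Convex ℝ (restrictFixed G '' C) := by
    rintro _ ⟨f, hf, rfl⟩ _ ⟨g, hg, rfl⟩ a b ha hb hab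
    exact ⟨a • f + b • g, hconv hf hg ha hb hab, by ext x; rfl⟩
  have hclosed : ∀ δ : ℝ, 0 < δ →
      IsClosed (toStrongDual ⁻¹' (Metric.closedBall 0 δ ∩ restrictFixed G '' C)) := by
    intro δ hδ
    obtain ⟨E, hEc, hE⟩ := h' δ hδ
    convert (WeakDual.isClosed_closedBall (0 : StrongDual 𝕜 (fixedSubmodule G)) δ).inter hEc
      using 1
    ext d
    simp only [mem_preimage, mem_inter_iff, mem_closedBall_zero_iff]
    refine and_congr_right fun hd => ?_
    -- The extension must keep the norm, so that it stays in the ball of radius `δ` where `E`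
    -- describes `C`.
    obtain ⟨f, hfd, hn⟩ := exists_restrictFixed_eq G (toStrongDual d)
    have hfE := hE f (hn.trans_le hd)
    rw [hfd] at hfE
    refine Iff.trans ⟨?_, fun hf => ⟨f, hf, hfd⟩⟩ hfE
    rintro ⟨g, hg, hgd⟩
    exact hsat g hg f (hfd.trans hgd.symm)
  let := weakStarG G
  rw [← isOpen_compl_iff, isOpen_iff_forall_mem_open]
  intro f₀ hf₀
  obtain ⟨y, hy⟩ := krein_smulian_separation hD hclosed (f₀ := restrictFixed G f₀) (by
    rintro ⟨f, hf, hff₀⟩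
    exact hf₀ (hsat f hf f₀ hff₀.symm))
  refine ⟨basicSet f₀ {(y : X)} 1, fun f hf hfC => ?_, ?_, ?_⟩
  · exact absurd (hy _ ⟨f, hfC, rfl⟩) (not_le.2 (hf y (Finset.mem_singleton_self _)))
  · exact TopologicalSpace.isOpen_generateFrom_of_mem
      ⟨f₀, {(y : X)}, 1, by rw [Finset.coe_singleton, singleton_subset_iff]; exact y.2, one_pos, rfl⟩
  · intro x _
    simp

end Fixed

end GInv

theorem mainTheorem5 {𝕜 : Type*} [RCLike 𝕜] {X : Type*} [NormedAddCommGroup X]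
    [NormedSpace 𝕜 X] [CompleteSpace X]
    (G : Subgroup (X ≃ₗᵢ[𝕜] X)) (hG : GInv.IsCompactGroup G)
    (C : Set (StrongDual 𝕜 X)) (hconv : Convex ℝ C) (hinv : GInv.IsDualInvariant G C) :
    ((∀ δ : ℝ, 0 < δ → IsClosed[GInv.weakStarG G] (Metric.closedBall 0 δ ∩ C)) →
      IsClosed[GInv.weakStarG G] C) ∧
    ((∀ δ : ℝ, 0 < δ → ∃ F : Set (StrongDual 𝕜 X), IsClosed[GInv.weakStarG G] F ∧
        Metric.closedBall 0 δ ∩ C = Metric.closedBall 0 δ ∩ F) →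
      IsClosed[GInv.weakStarG G] C) := by
  refine ⟨fun h => ?_, GInv.isClosed_weakStarG_of_inter_closedBall G hconv⟩
  -- The closed set is taken to be the intersection with the ball itself.
  refine GInv.isClosed_weakStarG_of_inter_closedBall G hconv fun δ hδ => ⟨_, h δ hδ, ?_⟩
  rw [← Set.inter_assoc, Set.inter_self]
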